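/- A di-sk tree is a (possibly empty) rooted binary tree, with left and right children distinguished, whose nodes are labeled by $\oplus$ or $\ominus$ and in which no node has the same label as its right child. For $n\ge 1$ let $\mathfrak{DT}_n$ be the finite set of di-sk trees with $n-1$ nodes. For a traversal of the nodes, the number of initial $\oplus$-nodes of $T$ is the number of $\oplus$-nodes visited before the first $\ominus$-node (all nodes, if there is no $\ominus$-node). Denote this number by $\mathsf{iop}(T)$, $\mathsf{riop}(T)$, $\mathsf{top}(T)$, $\mathsf{rtop}(T)$, $\mathsf{pop}(T)$, $\mathsf{rpop}(T)$, $\mathsf{lop}(T)$, $\mathsf{rlop}(T)$ for, respectively, the following eight traversals: inorder (Left–Root–Right), right inorder (Right–Root–Left), preorder (Root–Left–Right), right preorder (Root–Right–Left), postorder (Left–Right–Root), right postorder (Right–Left–Root), level order (level by level from the root down, each level from left to right), right level order (level by level from the root down, each level from right to left). Write $\mathsf{st}_1\sim\mathsf{st}_2$ if the two statistics are equidistributed over $\mathfrak{DT}_n$, i.e. $|\{T\in\mathfrak{DT}_n:\mathsf{st}_1(T)=k\}|=|\{T\in\mathfrak{DT}_n:\mathsf{st}_2(T)=k\}|$ for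 every $k\ge 0$. Theorem. For every $n\ge 1$: 1. $\mathsf{rtop}(T)=\mathsf{rlop}(T)$ for every $T\in\mathfrak{DT}_n$; 2. $\mathsf{riop}\sim\mathsf{iop}\sim\mathsf{top}\sim\mathsf{pop}\sim\mathsf{rpop}$; 3. if $n\ge 5$, the eight statistics fall into exactly three equidistribution classes over $\mathfrak{DT}_n$, namely $\{\mathsf{rtop},\mathsf{rlop}\}$, $\{\mathsf{riop},\mathsf{iop},\mathsf{top},\mathsf{pop},\mathsf{rpop}\}$ and $\{\mathsf{lop}\}$. In particular, for every $n\ge 5$ the distribution of $\mathsf{lop}$ differs from that of each of the other seven statistics. -/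

import Mathlib

namespace DiSk

/-- The two node labels `⊕` and `⊖`. -/
inductive Label : Type
  | oplus : Label
  | ominus : Label
  deriving DecidableEq

/-- Rooted binary trees (left and right children are distinguished, and a node may have either,
both or none of them) whose nodes are labeled by `⊕` or `⊖`; the empty tree is `nil`. -/
abbrev LTree : Type := BinaryTree Label

/-- The label of the root, if there is one. -/
def rootLabel : LTree → Option Label
  | .nil => none
  | .node a _ _ => some a

/-- No node has the same label as its right child. -/
def IsDiSk : LTree → Prop
  | .nil => True
  | .node a l r => rootLabel r ≠ some a ∧ IsDiSk l ∧ IsDiSk r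

/-- The di-sk trees with `n - 1` nodes (no tree for `n = 0`). -/
def diSkTrees (n : ℕ) : Set LTree := {T | IsDiSk T ∧ T.numNodes + 1 = n}

/-! The eight traversals, each as the list of node labels in the order of visit. -/

/-- Left - Root - Right. -/
def inorder : LTree → List Label
  | .nil => []
  | .node a l r => inorder l ++ [a] ++ inorder r

/-- Right - Root - Left. -/
def rightInorder : LTree → List Label
  | .nil => []
  | .node a l r => rightInorder r ++ [a] ++ rightInorder l

/-- Root - Left - Right. -/
def preorder : LTree → List Label
  | .nil => []
  | .node a l r => [a] ++ preorder l ++ preorder r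

/-- Root - Right - Left. -/
def rightPreorder : LTree → List Label
  | .nil => []
  | .node a l r => [a] ++ rightPreorder r ++ rightPreorder l

/-- Left - Right - Root. -/
def postorder : LTree → List Label
  | .nil => []
  | .node a l r => postorder l ++ postorder r ++ [a]

/-- Right - Left - Root. -/
def rightPostorder : LTree → List Label
  | .nil => []
  | .node a l r => rightPostorder r ++ rightPostorder l ++ [a]

/-- The labels of the nodes at distance `d` from the root, from left to right. -/
def level : ℕ → LTree → List Label
  | _, .nil => []
  | 0, .node a _ _ => [a]
  | d + 1, .node _ l r => level d l ++ level d r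

/-- The labels of the nodes at distance `d` from the root, from right to left. -/
def rightLevel : ℕ → LTree → List Label
  | _, .nil => []
  | 0, .node a _ _ => [a]
  | d + 1, .node _ l r => rightLevel d r ++ rightLevel d l

/-- Level by level from the root down, each level from left to right. -/
def levelOrder (T : LTree) : List Label :=
  (List.range T.height).flatMap fun d => level d T

/-- Level by level from the root down, each level from right to left. -/
def rightLevelOrder (T : LTree) : List Label :=
  (List.range T.height).flatMap fun d => rightLevel d T

/-- The number of `⊕` before the first `⊖` (all entries, if there is no `⊖`). -/
def initialPlus (w : List Label) : ℕ := (w.takeWhile fun s => decide (s = Label.oplus)).length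

def iop (T : LTree) : ℕ := initialPlus (inorder T)
def riop (T : LTree) : ℕ := initialPlus (rightInorder T)
def top (T : LTree) : ℕ := initialPlus (preorder T)
def rtop (T : LTree) : ℕ := initialPlus (rightPreorder T)
def pop (T : LTree) : ℕ := initialPlus (postorder T)
def rpop (T : LTree) : ℕ := initialPlus (rightPostorder T)
def lop (T : LTree) : ℕ := initialPlus (levelOrder T)
def rlop (T : LTree) : ℕ := initialPlus (rightLevelOrder T)

/-- Two statistics have the same distribution over `S`: every value is taken on equally many
elements of `S`. (It is applied to finite sets `S` only, see `finite_diSkTrees`.) -/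
def Equidistributed (S : Set LTree) (st₁ st₂ : LTree → ℕ) : Prop :=
  ∀ k : ℕ, {T ∈ S | st₁ T = k}.ncard = {T ∈ S | st₂ T = k}.ncard

theorem finite_numNodes_lt (m : ℕ) : {T : LTree | T.numNodes < m}.Finite := by
  induction m with
  | zero => simp
  | succ m ih =>
    have hL : (Set.univ : Set Label).Finite :=
      Set.Finite.subset (Set.toFinite {Label.oplus, Label.ominus}) (by rintro (_ | _) _ <;> simp)
    have h := (((hL.prod (ih.prod ih)).image
      fun p : Label × LTree × LTree => BinaryTree.node p.1 p.2.1 p.2.2).insert BinaryTree.nil)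
    refine h.subset ?_
    rintro (_ | ⟨a, l, r⟩) hT
    · exact Set.mem_insert _ _
    · simp only [Set.mem_ofPred_eq, BinaryTree.numNodes] at hT
      refine Set.mem_insert_of_mem _ ⟨(a, l, r), ⟨Set.mem_univ _, ?_, ?_⟩, rfl⟩
      · show l.numNodes < m
        omega
      · show r.numNodes < m
        omega

theorem finite_diSkTrees (n : ℕ) : (diSkTrees n).Finite :=
  (finite_numNodes_lt n).subset fun T hT => by
    have := hT.2
    show T.numNodes < n
    omega

end DiSk

/-! Equidistribution. Let `x` count nodes, let `t` mark a statistic, and let `S` be the series of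
all di-sk trees. Each of `top`, `iop`, `riop`, `pop`, `rpop` has a generating function `F` with `(1
- x S - t x) F = 1`, and this factor can be cancelled, so the five series coincide. To get the
equation, split `t ^ st` into a part `plusWeight` for words without `⊖` and a part `minusWeight` for
words with one. Both behave well under concatenation, so cutting a tree at its root gives a small
system of equations for each traversal (the `kernelSeries_mul_*` lemmas).

The identity `rtop = rlop` holds tree by tree: below a root `⊕` the right child is empty or `⊖`. If
it is `⊖`, both traversals visit it second; if it is empty, both continue in the left subtree.

Separation. Among the trees with `N = n - 1` nodes, count those with the value `N - 1`. There are at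
most 2 for `rtop` (`ncard_fiber_rtop_le`), exactly 3 for `lop` (`ncard_fiber_lop`), and at least `N`
for `top` (`le_ncard_fiber_top`). These counts differ as soon as `N ≥ 4`. -/

namespace DiSk

open PowerSeries

/-! ### Generating functions of weighted trees and the cut at the root -/

section GeneratingFunctions

variable {R : Type*} [CommRing R]

/-- The labeled binary trees with `m` nodes. -/
noncomputable def treesOfSize (m : ℕ) : Finset LTree :=
  ((finite_numNodes_lt (m + 1)).subset fun T (hT : T.numNodes = m) => by
    show T.numNodes < m + 1
    omega : {T : LTree | T.numNodes = m}.Finite).toFinset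

theorem mem_treesOfSize {m : ℕ} {T : LTree} : T ∈ treesOfSize m ↔ T.numNodes = m := by
  simp [treesOfSize]

theorem treesOfSize_zero : treesOfSize 0 = {BinaryTree.nil} := by
  ext T
  cases T <;> simp [mem_treesOfSize]

/-- The generating function of a weight on labeled trees, by the number of nodes. -/
noncomputable def gf (w : LTree → R) : R⟦X⟧ := .mk fun m => ∑ T ∈ treesOfSize m, w T

/-- The generating function of a weight on pairs of labeled trees, by the total number of nodes. -/
noncomputable def pairGF (c : LTree → LTree → R) : R⟦X⟧ :=
  .mk fun m => ∑ p ∈ Finset.HasAntidiagonal.antidiagonal m, ∑ l ∈ treesOfSize p.1, ∑ r ∈ treesOfSize p.2, c l r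

theorem gf_add (v w : LTree → R) : gf (fun T => v T + w T) = gf v + gf w := by
  ext m
  simp [gf, Finset.sum_add_distrib]

theorem pairGF_add (c d : LTree → LTree → R) :
    pairGF (fun l r => c l r + d l r) = pairGF c + pairGF d := by
  ext m
  simp [pairGF, Finset.sum_add_distrib]

theorem pairGF_mul (f g : LTree → R) : pairGF (fun l r => f l * g r) = gf f * gf g := by
  ext m
  simp [pairGF, gf, coeff_mul, Finset.sum_mul_sum]

theorem sum_treesOfSize_succ (w : LTree → R) (m : ℕ) :
    ∑ T ∈ treesOfSize (m + 1), w T =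
      ∑ p ∈ Finset.HasAntidiagonal.antidiagonal m, ∑ l ∈ treesOfSize p.1, ∑ r ∈ treesOfSize p.2,
        (w (.node .oplus l r) + w (.node .ominus l r)) := by
  have hpair (l r : LTree) : w (.node .oplus l r) + w (.node .ominus l r) =
      ∑ a ∈ ({.oplus, .ominus} : Finset Label), w (.node a l r) := by
    rw [Finset.sum_pair (by simp)]
  simp_rw [hpair, Finset.sum_sigma']
  symm
  refine Finset.sum_bij (fun q _ => .node q.2.2.2 q.2.1 q.2.2.1) ?_ ?_ ?_ ?_
  · rintro ⟨⟨i, j⟩, l, r, a⟩ h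
    simp only [Finset.mem_sigma, Finset.HasAntidiagonal.mem_antidiagonal, mem_treesOfSize] at h ⊢
    simp only [BinaryTree.numNodes]
    omega
  · rintro ⟨⟨i, j⟩, l, r, a⟩ h ⟨⟨i', j'⟩, l', r', a'⟩ h' e
    simp only [Finset.mem_sigma, mem_treesOfSize] at h h'
    simp only [BinaryTree.node.injEq] at e
    obtain ⟨rfl, rfl, rfl⟩ := e
    obtain ⟨-, rfl, rfl, -⟩ := h
    obtain ⟨-, rfl, rfl, -⟩ := h'
    rfl
  · rintro (_ | ⟨a, l, r⟩) h
    · simp [mem_treesOfSize] at h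
    · refine ⟨⟨(l.numNodes, r.numNodes), l, r, a⟩, ?_, rfl⟩
      simp only [mem_treesOfSize, BinaryTree.numNodes] at h
      simp only [Finset.mem_sigma, Finset.HasAntidiagonal.mem_antidiagonal, mem_treesOfSize]
      refine ⟨by omega, trivial, trivial, ?_⟩
      cases a <;> simp
  · intro q _
    rfl

theorem gf_eq (w : LTree → R) :
    gf w = C (w .nil) +
      X * (pairGF (fun l r => w (.node .oplus l r)) + pairGF fun l r => w (.node .ominus l r)) := by
  rw [← pairGF_add]
  ext m
  cases m with
  | zero => simp [gf, treesOfSize_zero]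
  | succ m => simp [gf, pairGF, sum_treesOfSize_succ, coeff_succ_X_mul]

end GeneratingFunctions

/-! ### Indicators of di-sk trees -/

open scoped Classical in
/-- The indicator of the di-sk trees. -/
noncomputable def diSkInd (R : Type*) [CommRing R] (T : LTree) : R := if IsDiSk T then 1 else 0

open scoped Classical in
/-- The indicator of the di-sk trees with root labeled `a`. -/
noncomputable def rootInd (R : Type*) [CommRing R] (a : Label) (T : LTree) : R :=
  if IsDiSk T ∧ rootLabel T = some a then 1 else 0

/-- The other label. -/
def Label.swap : Label → Label
  | .oplus => .ominus
  | .ominus => .oplus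

section Indicators

variable {R : Type*} [CommRing R]

open scoped Classical in
/-- The indicator of the empty tree. -/
noncomputable def nilInd (R : Type*) [CommRing R] (T : LTree) : R := if T = .nil then 1 else 0

theorem diSkInd_eq (T : LTree) :
    diSkInd R T = nilInd R T + rootInd R .oplus T + rootInd R .ominus T := by
  by_cases h : IsDiSk T
  · rcases T with _ | ⟨_ | _, l, r⟩ <;> simp [diSkInd, rootInd, nilInd, rootLabel, h]
  · have hT : T ≠ .nil := fun e => h (e ▸ trivial)
    simp [diSkInd, rootInd, nilInd, h, hT]

theorem rootInd_nil (a : Label) : rootInd R a .nil = 0 := by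
  simp [rootInd, rootLabel]

/-- The di-sk condition at the root involves only the label of the right child, so the indicator is
a product of a function of `l` and a function of `r`. This is what turns root decompositions into
products of series. -/
theorem rootInd_node_self (a : Label) (l r : LTree) :
    rootInd R a (.node a l r) = diSkInd R l * (nilInd R r + rootInd R a.swap r) := by
  have hnode : IsDiSk (.node a l r) ∧ rootLabel (.node a l r) = some a ↔
      IsDiSk l ∧ (r = .nil ∨ IsDiSk r ∧ rootLabel r = some a.swap) := by
    cases a <;> rcases r with _ | ⟨_ | _, r₁, r₂⟩ <;>
      simp +contextual [rootLabel, IsDiSk, Label.swap]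
  have hnil : r = .nil → ¬(IsDiSk r ∧ rootLabel r = some a.swap) := by
    rintro rfl
    simp [rootLabel]
  classical
  have hL : rootInd R a (.node a l r) =
      if IsDiSk l ∧ (r = .nil ∨ IsDiSk r ∧ rootLabel r = some a.swap) then 1 else 0 := by
    unfold rootInd
    exact if_congr hnode rfl rfl
  rw [hL]
  unfold rootInd diSkInd nilInd
  by_cases hl : IsDiSk l <;> by_cases hr : r = .nil <;>
    by_cases hr' : IsDiSk r ∧ rootLabel r = some a.swap
  all_goals first
    | exact absurd hr' (hnil hr)
    | simp only [hl, hr', or_false, or_true, true_and, false_and, if_true, if_false, add_zero,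
        one_mul, zero_mul]
      try simp [hr]

theorem rootInd_node_of_ne {a b : Label} (h : b ≠ a) (l r : LTree) :
    rootInd R a (.node b l r) = 0 := by
  simp [rootInd, rootLabel, h]

theorem pairGF_zero : pairGF (fun _ _ => (0 : R)) = 0 := by
  ext m
  simp [pairGF]

theorem gf_nilInd_mul (g : LTree → R) : gf (fun T => nilInd R T * g T) = C (g .nil) := by
  rw [gf_eq]
  simp only [nilInd, reduceCtorEq, if_false, zero_mul, if_true, one_mul, pairGF_zero,
    add_zero, mul_zero]

theorem gf_diSkInd_mul (g : LTree → R) :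
    gf (fun T => diSkInd R T * g T) = C (g .nil) + gf (fun T => rootInd R .oplus T * g T) +
      gf (fun T => rootInd R .ominus T * g T) := by
  simp_rw [diSkInd_eq, add_mul, gf_add, gf_nilInd_mul]

theorem gf_rootInd_mul (a : Label) (ω : LTree → R) :
    gf (fun T => rootInd R a T * ω T) = X * pairGF fun l r =>
      diSkInd R l * (nilInd R r + rootInd R a.swap r) * ω (.node a l r) := by
  rw [gf_eq]
  cases a <;> simp [rootInd_nil, rootInd_node_self, rootInd_node_of_ne, pairGF_zero]

/-- The root decomposition of a weight that is a sum of two products. -/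
theorem gf_rootInd_mul_of_eq (a : Label) {ω f g f' g' : LTree → R}
    (h : ∀ l r, ω (.node a l r) = f l * g r + f' l * g' r) :
    gf (fun T => rootInd R a T * ω T) =
      X * (gf (fun T => diSkInd R T * f T) * (C (g .nil) + gf fun T => rootInd R a.swap T * g T) +
        gf (fun T => diSkInd R T * f' T) *
          (C (g' .nil) + gf fun T => rootInd R a.swap T * g' T)) := by
  have key (l r : LTree) :
      diSkInd R l * (nilInd R r + rootInd R a.swap r) * ω (.node a l r) =
        diSkInd R l * f l * (nilInd R r * g r + rootInd R a.swap r * g r) +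
        diSkInd R l * f' l * (nilInd R r * g' r + rootInd R a.swap r * g' r) := by
    rw [h]; ring
  rw [gf_rootInd_mul]
  simp_rw [key, pairGF_add]
  rw [pairGF_mul (fun l => diSkInd R l * f l)
    (fun r => nilInd R r * g r + rootInd R a.swap r * g r),
    pairGF_mul (fun l => diSkInd R l * f' l)
    (fun r => nilInd R r * g' r + rootInd R a.swap r * g' r), gf_add, gf_add, gf_nilInd_mul,
    gf_nilInd_mul]

/-- The root decomposition of a weight that is a product. -/
theorem gf_rootInd_mul_of_eq_mul (a : Label) {ω f g : LTree → R}
    (h : ∀ l r, ω (.node a l r) = f l * g r) :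
    gf (fun T => rootInd R a T * ω T) =
      X * (gf (fun T => diSkInd R T * f T) *
        (C (g .nil) + gf fun T => rootInd R a.swap T * g T)) := by
  have h0 : gf (fun _ => (0 : R)) = 0 := by
    ext m
    simp [gf]
  rw [gf_rootInd_mul_of_eq (f := f) (g := g) (f' := fun _ => 0) (g' := fun _ => 0) a
    (fun l r => by rw [h]; simp)]
  simp [h0]

theorem gf_mul_mul_const (v w : LTree → R) (c : R) :
    gf (fun T => v T * (w T * c)) = gf (fun T => v T * w T) * C c := by
  ext m
  simp [gf, Finset.sum_mul, mul_assoc]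

end Indicators

/-! ### Weights of words -/

/-- `t ^ length u` if all entries of `u` are `⊕`, and `0` otherwise. -/
noncomputable def plusWeight : List Label → Polynomial ℤ
  | [] => 1
  | .oplus :: u => Polynomial.X * plusWeight u
  | .ominus :: _ => 0

/-- `t ^ initialPlus u` if `u` has an entry `⊖`, and `0` otherwise. -/
noncomputable def minusWeight : List Label → Polynomial ℤ
  | [] => 0
  | .oplus :: u => Polynomial.X * minusWeight u
  | .ominus :: _ => 1

theorem plusWeight_append (u v : List Label) :
    plusWeight (u ++ v) = plusWeight u * plusWeight v := by
  induction u with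
  | nil => simp [plusWeight]
  | cons a u ih => cases a <;> simp [plusWeight, ih, mul_assoc]

theorem minusWeight_append (u v : List Label) :
    minusWeight (u ++ v) = minusWeight u + plusWeight u * minusWeight v := by
  induction u with
  | nil => simp [plusWeight, minusWeight]
  | cons a u ih => cases a <;> simp [plusWeight, minusWeight, ih, mul_assoc, mul_add]

theorem plusWeight_add_minusWeight (u : List Label) :
    plusWeight u + minusWeight u = Polynomial.X ^ initialPlus u := by
  induction u with
  | nil => simp [plusWeight, minusWeight, initialPlus]
  | cons a u ih =>
    cases a
    · simp only [plusWeight, minusWeight, ← mul_add, ih]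
      simp [initialPlus, pow_succ']
    · simp [plusWeight, minusWeight, initialPlus]

/-! ### Counting di-sk trees -/

/-- The generating function of the di-sk trees. -/
noncomputable def diSkGF : (Polynomial ℤ)⟦X⟧ := gf (diSkInd _)

/-- The generating function of the di-sk trees with root `a`. -/
noncomputable def rootGF (a : Label) : (Polynomial ℤ)⟦X⟧ := gf (rootInd _ a)

theorem rootGF_eq (a : Label) : rootGF a = X * (diSkGF * (1 + rootGF a.swap)) := by
  have := gf_rootInd_mul_of_eq_mul (R := Polynomial ℤ) a (ω := fun _ => 1) (f := fun _ => 1)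
    (g := fun _ => 1) (by simp)
  simp only [mul_one, map_one] at this
  exact this

theorem ne_zero_of_constantCoeff {F : (Polynomial ℤ)⟦X⟧} (h : constantCoeff F = 1) : F ≠ 0 := by
  rintro rfl
  simp at h

/-- Subtracting the two root equations leaves `(1 + x S)` times the difference of the two series,
which must vanish. No label-swapping bijection is needed. -/
theorem rootGF_ominus : rootGF .ominus = rootGF .oplus := by
  have h₁ := rootGF_eq .oplus
  have h₂ := rootGF_eq .ominus
  simp only [Label.swap] at h₁ h₂
  have h0 : (1 + X * diSkGF : (Polynomial ℤ)⟦X⟧) ≠ 0 := ne_zero_of_constantCoeff (by simp)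
  refine mul_left_cancel₀ h0 ?_
  linear_combination h₂ - h₁

theorem rootGF_oplus : rootGF .oplus = X * (diSkGF * (1 + rootGF .oplus)) := by
  conv_lhs => rw [rootGF_eq]
  rw [Label.swap, rootGF_ominus]

theorem diSkGF_eq : diSkGF = 1 + 2 * rootGF .oplus := by
  have := gf_diSkInd_mul (R := Polynomial ℤ) fun _ => 1
  simp only [mul_one, map_one] at this
  change diSkGF = 1 + rootGF .oplus + rootGF .ominus at this
  rw [this, rootGF_ominus]
  ring

/-! ### Generating functions of the statistics -/

/-- The generating function of a statistic on di-sk trees, marked by the polynomial variable. -/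
noncomputable def statGF (st : LTree → ℕ) : (Polynomial ℤ)⟦X⟧ :=
  gf fun T => diSkInd _ T * Polynomial.X ^ st T

theorem ncard_diSkTrees_succ (m k : ℕ) (st : LTree → ℕ) :
    ({T ∈ diSkTrees (m + 1) | st T = k}.ncard : ℤ) =
      (coeff m (statGF st)).coeff k := by
  classical
  have : {T ∈ diSkTrees (m + 1) | st T = k} =
      ((treesOfSize m).filter fun T => IsDiSk T ∧ st T = k : Finset LTree) := by
    ext T
    simp only [diSkTrees, Set.mem_ofPred_eq, Finset.coe_filter, mem_treesOfSize]
    constructor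
    · rintro ⟨⟨h₁, h₂⟩, h₃⟩
      exact ⟨by omega, h₁, h₃⟩
    · rintro ⟨h₁, h₂, h₃⟩
      exact ⟨⟨h₂, by omega⟩, h₃⟩
  rw [this, Set.ncard_coe_finset, Finset.card_filter, statGF, gf, coeff_mk, Polynomial.finsetSum_coeff]
  push_cast
  refine Finset.sum_congr rfl fun T _ => ?_
  by_cases h : IsDiSk T <;> simp [diSkInd, h, Polynomial.coeff_X_pow, eq_comm]

theorem diSkTrees_zero : diSkTrees 0 = ∅ := by
  ext T
  simp [diSkTrees]

theorem equidistributed_of_statGF_eq {st₁ st₂ : LTree → ℕ} (h : statGF st₁ = statGF st₂) (n : ℕ) :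
    Equidistributed (diSkTrees n) st₁ st₂ := by
  intro k
  cases n with
  | zero => simp [diSkTrees_zero]
  | succ m =>
    have := ncard_diSkTrees_succ m k st₁
    rw [h, ← ncard_diSkTrees_succ] at this
    exact_mod_cast this

/-- `t x` as a power series. -/
noncomputable def markedX : (Polynomial ℤ)⟦X⟧ := X * C Polynomial.X

section Traversal

variable (W : LTree → List Label)

/-- The part of `statGF` from all trees without `⊖`. -/
noncomputable def plusGF : (Polynomial ℤ)⟦X⟧ := gf fun T => diSkInd _ T * plusWeight (W T)

/-- The part of `statGF` from the trees with root `a` and at least one `⊖`. -/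
noncomputable def minusGF (a : Label) : (Polynomial ℤ)⟦X⟧ :=
  gf fun T => rootInd _ a T * minusWeight (W T)

variable {W}

theorem gf_rootInd_ominus_plusWeight
    (hW : ∀ a l r, plusWeight (W (.node a l r)) =
      plusWeight [a] * plusWeight (W l) * plusWeight (W r)) :
    gf (fun T => rootInd _ .ominus T * plusWeight (W T)) = 0 := by
  rw [gf_rootInd_mul]
  simp [hW, plusWeight, pairGF_zero]

theorem gf_rootInd_oplus_plusWeight (hnil : W .nil = [])
    (hW : ∀ a l r, plusWeight (W (.node a l r)) =
      plusWeight [a] * plusWeight (W l) * plusWeight (W r)) :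
    gf (fun T => rootInd _ .oplus T * plusWeight (W T)) = plusGF W - 1 := by
  rw [plusGF, gf_diSkInd_mul, gf_rootInd_ominus_plusWeight hW, hnil]
  simp [plusWeight]

/-- A di-sk tree without `⊖` has no right children, so it is a left chain and there is one of each
size: the series is `1 / (1 - t x)`, whatever the traversal. -/
theorem plusGF_eq (hnil : W .nil = [])
    (hW : ∀ a l r, plusWeight (W (.node a l r)) =
      plusWeight [a] * plusWeight (W l) * plusWeight (W r)) :
    plusGF W = 1 + markedX * plusGF W := by
  -- The factor `t` of the root is absorbed into `f`, to match the shape `f l * g r`;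
  -- `gf_mul_mul_const` takes it out again.
  have h := gf_rootInd_mul_of_eq_mul (R := Polynomial ℤ) .oplus (ω := fun T => plusWeight (W T))
    (f := fun T => plusWeight (W T) * Polynomial.X) (g := fun T => plusWeight (W T))
    (fun l r => by rw [hW]; simp only [plusWeight]; ring)
  rw [gf_mul_mul_const, gf_rootInd_oplus_plusWeight hnil hW, Label.swap,
    gf_rootInd_ominus_plusWeight hW, hnil] at h
  simp only [plusWeight, map_one, add_zero, mul_one] at h
  rw [← plusGF] at h
  rw [markedX]
  linear_combination h

theorem gf_diSkInd_minusWeight (hnil : W .nil = []) :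
    gf (fun T => diSkInd _ T * minusWeight (W T)) = minusGF W .oplus + minusGF W .ominus := by
  rw [gf_diSkInd_mul, hnil]
  simp [minusWeight, minusGF]

theorem statGF_eq (hnil : W .nil = []) :
    statGF (fun T => initialPlus (W T)) = plusGF W + minusGF W .oplus + minusGF W .ominus := by
  simp_rw [statGF, ← plusWeight_add_minusWeight, mul_add, gf_add, gf_diSkInd_minusWeight hnil]
  rw [plusGF, add_assoc]

end Traversal

/-! ### The kernel equation for the five statistics -/

theorem gf_mul_add {R : Type*} [CommRing R] (v f g : LTree → R) :
    gf (fun T => v T * (f T + g T)) = gf (fun T => v T * f T) + gf fun T => v T * g T := by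
  simp_rw [mul_add, gf_add]

/-- `1 - x * S - t * x`, where `S` counts the di-sk trees. -/
noncomputable def kernelSeries : (Polynomial ℤ)⟦X⟧ := 1 - X * diSkGF - markedX

theorem kernelSeries_ne_zero : kernelSeries ≠ 0 :=
  ne_zero_of_constantCoeff (by simp [kernelSeries, markedX])

theorem gf_diSkInd_mul_one : gf (fun T => diSkInd _ T * 1) = diSkGF := by
  simp only [mul_one]
  rfl

theorem gf_rootInd_mul_one (a : Label) : gf (fun T => rootInd _ a T * 1) = rootGF a := by
  simp only [mul_one]
  rfl

theorem gf_diSkInd_plusWeight (W : LTree → List Label) :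
    gf (fun T => diSkInd _ T * plusWeight (W T)) = plusGF W := rfl

theorem gf_rootInd_minusWeight (W : LTree → List Label) (a : Label) :
    gf (fun T => rootInd _ a T * minusWeight (W T)) = minusGF W a := rfl

theorem kernelSeries_mul_top : kernelSeries * statGF top = 1 := by
  have hα (a : Label) (l r : LTree) : plusWeight (preorder (.node a l r)) =
      plusWeight [a] * plusWeight (preorder l) * plusWeight (preorder r) := by
    simp only [preorder, plusWeight_append]
  have hA := plusGF_eq (W := preorder) rfl hα
  have hF := statGF_eq (W := preorder) rfl
  have hp := gf_rootInd_mul_of_eq (R := Polynomial ℤ) .oplus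
    (ω := fun T => minusWeight (preorder T))
    (f := fun T => minusWeight (preorder T) * Polynomial.X) (g := fun _ => 1)
    (f' := fun T => plusWeight (preorder T) * Polynomial.X)
    (g' := fun T => minusWeight (preorder T))
    (fun l r => by simp only [preorder, minusWeight_append, minusWeight, plusWeight,
      plusWeight_append]; ring)
  have hq := gf_rootInd_mul_of_eq_mul (R := Polynomial ℤ) .ominus
    (ω := fun T => minusWeight (preorder T)) (f := fun _ => 1) (g := fun _ => 1)
    (fun l r => by simp only [preorder, minusWeight_append, plusWeight_append, minusWeight, plusWeight]; ring)
  rw [gf_mul_mul_const, gf_mul_mul_const, gf_diSkInd_minusWeight rfl, gf_rootInd_mul_one] at hp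
  rw [gf_diSkInd_mul_one, gf_rootInd_mul_one] at hq
  simp only [gf_diSkInd_plusWeight, gf_rootInd_minusWeight, Label.swap, preorder, minusWeight, map_one, map_zero,
    rootGF_ominus] at hp hq
  change statGF top = _ at hF
  have hR := rootGF_oplus
  rw [kernelSeries]
  rw [markedX] at hA ⊢
  -- From here on only an identity in a commutative ring remains, to be derived from the equations
  -- at hand.
  generalize statGF top = F at *
  generalize plusGF preorder = A at *
  generalize minusGF preorder .oplus = p at *
  generalize minusGF preorder .ominus = q at *
  generalize rootGF .oplus = ρ at *
  generalize diSkGF = S at *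
  generalize (C Polynomial.X : (Polynomial ℤ)⟦X⟧) = t at *
  generalize (X : (Polynomial ℤ)⟦X⟧) = x at *
  have h₁ : F = 1 + ρ + x * t * F * (1 + ρ) := by
    linear_combination (1 - x * t * (1 + ρ)) * hF + hA + hp + (1 + A * x * t) * hq -
      (1 + A * x * t) * hR
  -- The root equation says `(1 - x S)(1 + ρ) = 1`, which clears `1 + ρ` from `h₁`.
  linear_combination (1 - x * S) * h₁ + (1 + x * t * F) * hR

theorem kernelSeries_mul_iop : kernelSeries * statGF iop = 1 := by
  have hα (a : Label) (l r : LTree) : plusWeight (inorder (.node a l r)) =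
      plusWeight [a] * plusWeight (inorder l) * plusWeight (inorder r) := by
    simp only [inorder, plusWeight_append]
    ring
  have hA := plusGF_eq (W := inorder) rfl hα
  have hF := statGF_eq (W := inorder) rfl
  have hp := gf_rootInd_mul_of_eq (R := Polynomial ℤ) .oplus
    (ω := fun T => minusWeight (inorder T))
    (f := fun T => minusWeight (inorder T)) (g := fun _ => 1)
    (f' := fun T => plusWeight (inorder T) * Polynomial.X)
    (g' := fun T => minusWeight (inorder T))
    (fun l r => by simp only [inorder, minusWeight_append, minusWeight, plusWeight,
      plusWeight_append]; ring)
  have hq := gf_rootInd_mul_of_eq_mul (R := Polynomial ℤ) .ominus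
    (ω := fun T => minusWeight (inorder T))
    (f := fun T => plusWeight (inorder T) + minusWeight (inorder T)) (g := fun _ => 1)
    (fun l r => by simp only [inorder, minusWeight_append, minusWeight, plusWeight,
      plusWeight_append]; ring)
  rw [gf_mul_mul_const, gf_diSkInd_minusWeight rfl, gf_rootInd_mul_one] at hp
  rw [gf_mul_add, gf_diSkInd_minusWeight rfl, gf_rootInd_mul_one] at hq
  simp only [gf_diSkInd_plusWeight, gf_rootInd_minusWeight, Label.swap, inorder, minusWeight, map_one, map_zero,
    rootGF_ominus] at hp hq
  change statGF iop = _ at hF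
  have hR := rootGF_oplus
  have hS := diSkGF_eq
  -- Eliminating `p`, `q` and `A` yields the kernel equation times this factor, which has constant
  -- term 1 and can be cancelled.
  have h0 : (1 - X * (1 + rootGF .oplus) : (Polynomial ℤ)⟦X⟧) ≠ 0 :=
    ne_zero_of_constantCoeff (by simp)
  refine mul_left_cancel₀ h0 ?_
  rw [kernelSeries]
  rw [markedX] at hA ⊢
  generalize statGF iop = F at *
  generalize plusGF inorder = A at *
  generalize minusGF inorder .oplus = p at *
  generalize minusGF inorder .ominus = q at *
  generalize rootGF .oplus = ρ at *
  generalize diSkGF = S at *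
  generalize (C Polynomial.X : (Polynomial ℤ)⟦X⟧) = t at *
  generalize (X : (Polynomial ℤ)⟦X⟧) = x at *
  have hq' : q = x * (F * (1 + ρ)) := by linear_combination hq - x * (1 + ρ) * hF
  have hp' : p = x * ((F - A) * (1 + ρ) + A * t * q) := by
    linear_combination hp - x * (1 + ρ) * hF
  have h₁ : F * (1 - x * t) = 1 + (1 - x * t) * x * (F - A) * (1 + ρ) + t * x * q +
      (1 - x * t) * x * F * (1 + ρ) := by
    linear_combination (1 - x * t) * (hF + hp' + hq') + hA + (x * t * q) * hA
  have h₂ : F * ((1 - 2 * x * (1 + ρ)) - x * t * (1 - x * (1 + ρ))) = 1 - x * (1 + ρ) := by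
    linear_combination h₁ + t * x * hq' - x * (1 + ρ) * hA
  have h₃ : 1 - 2 * x * (1 + ρ) = (1 - x * (1 + ρ)) * (1 - x * S) := by
    linear_combination x * hS + x * hR
  linear_combination h₂ - F * h₃

theorem kernelSeries_mul_riop : kernelSeries * statGF riop = 1 := by
  have hα (a : Label) (l r : LTree) : plusWeight (rightInorder (.node a l r)) =
      plusWeight [a] * plusWeight (rightInorder l) * plusWeight (rightInorder r) := by
    simp only [rightInorder, plusWeight_append]
    ring
  have hA := plusGF_eq (W := rightInorder) rfl hα
  have hF := statGF_eq (W := rightInorder) rfl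
  have hM := gf_rootInd_ominus_plusWeight hα
  have hP := gf_rootInd_oplus_plusWeight rfl hα
  have hp := gf_rootInd_mul_of_eq (R := Polynomial ℤ) .oplus
    (ω := fun T => minusWeight (rightInorder T))
    (f := fun _ => 1) (g := fun T => minusWeight (rightInorder T))
    (f' := fun T => minusWeight (rightInorder T) * Polynomial.X)
    (g' := fun T => plusWeight (rightInorder T))
    (fun l r => by simp only [rightInorder, minusWeight_append, minusWeight, plusWeight,
      plusWeight_append]; ring)
  have hq := gf_rootInd_mul_of_eq_mul (R := Polynomial ℤ) .ominus
    (ω := fun T => minusWeight (rightInorder T))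
    (f := fun _ => 1)
    (g := fun T => minusWeight (rightInorder T) + plusWeight (rightInorder T))
    (fun l r => by simp only [rightInorder, minusWeight_append, minusWeight, plusWeight,
      plusWeight_append]; ring)
  rw [gf_mul_mul_const, gf_diSkInd_minusWeight rfl, gf_diSkInd_mul_one, Label.swap, hM] at hp
  rw [gf_mul_add, gf_diSkInd_mul_one, Label.swap, hP] at hq
  simp only [gf_rootInd_minusWeight, rightInorder, minusWeight, plusWeight, map_one, map_zero,
    zero_add] at hp hq
  change statGF riop = _ at hF
  rw [kernelSeries]
  rw [markedX] at hA ⊢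
  generalize statGF riop = F at *
  generalize plusGF rightInorder = A at *
  generalize minusGF rightInorder .oplus = p at *
  generalize minusGF rightInorder .ominus = q at *
  generalize diSkGF = S at *
  generalize (C Polynomial.X : (Polynomial ℤ)⟦X⟧) = t at *
  generalize (X : (Polynomial ℤ)⟦X⟧) = x at *
  -- Adding the equations for `A`, `p` and `q` already gives `F = 1 + x S F + t x F`; nothing about
  -- `S` is used.
  linear_combination (1 - x * S - x * t) * hF + hA + hp + hq

theorem kernelSeries_mul_pop : kernelSeries * statGF pop = 1 := by
  have hα (a : Label) (l r : LTree) : plusWeight (postorder (.node a l r)) =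
      plusWeight [a] * plusWeight (postorder l) * plusWeight (postorder r) := by
    simp only [postorder, plusWeight_append]
    ring
  have hA := plusGF_eq (W := postorder) rfl hα
  have hF := statGF_eq (W := postorder) rfl
  have hP := gf_rootInd_oplus_plusWeight rfl hα
  have hp := gf_rootInd_mul_of_eq (R := Polynomial ℤ) .oplus
    (ω := fun T => minusWeight (postorder T))
    (f := fun T => minusWeight (postorder T)) (g := fun _ => 1)
    (f' := fun T => plusWeight (postorder T))
    (g' := fun T => minusWeight (postorder T))
    (fun l r => by simp only [postorder, minusWeight_append, minusWeight, plusWeight_append]; ring)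
  have hq := gf_rootInd_mul_of_eq (R := Polynomial ℤ) .ominus
    (ω := fun T => minusWeight (postorder T))
    (f := fun T => minusWeight (postorder T)) (g := fun _ => 1)
    (f' := fun T => plusWeight (postorder T))
    (g' := fun T => minusWeight (postorder T) + plusWeight (postorder T))
    (fun l r => by simp only [postorder, minusWeight_append, minusWeight, plusWeight_append]; ring)
  rw [gf_diSkInd_minusWeight rfl, gf_rootInd_mul_one] at hp
  rw [gf_diSkInd_minusWeight rfl, gf_rootInd_mul_one, gf_mul_add, Label.swap, hP] at hq
  simp only [gf_diSkInd_plusWeight, gf_rootInd_minusWeight, Label.swap, postorder, minusWeight, plusWeight, map_one,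
    map_zero, zero_add, rootGF_ominus] at hp hq
  change statGF pop = _ at hF
  have hR := rootGF_oplus
  have hS := diSkGF_eq
  have h0 : (1 - 2 * X * (1 + rootGF .oplus) : (Polynomial ℤ)⟦X⟧) ≠ 0 :=
    ne_zero_of_constantCoeff (by simp)
  refine mul_left_cancel₀ h0 ?_
  rw [kernelSeries]
  rw [markedX] at hA ⊢
  generalize statGF pop = F at *
  generalize plusGF postorder = A at *
  generalize minusGF postorder .oplus = p at *
  generalize minusGF postorder .ominus = q at *
  generalize rootGF .oplus = ρ at *
  generalize diSkGF = S at *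
  generalize (C Polynomial.X : (Polynomial ℤ)⟦X⟧) = t at *
  generalize (X : (Polynomial ℤ)⟦X⟧) = x at *
  have h₁ : F - A = 2 * x * (1 + ρ) * (F - A) + x * A * F := by
    linear_combination (1 - 2 * x * (1 + ρ) - x * A) * hF + hp + hq
  have h₂ : F * ((1 - 2 * x * (1 + ρ)) * (1 - x * t) - x) = 1 - 2 * x * (1 + ρ) := by
    linear_combination (1 - x * t) * h₁ + (1 - 2 * x * (1 + ρ) + x * F) * hA
  -- The cancelled factor is the inverse of `S`, so the term `x` in `h₂` becomes this factor times
  -- `x S`.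
  have h₃ : (1 - 2 * x * (1 + ρ)) * S = 1 := by
    linear_combination hS + 2 * hR
  linear_combination h₂ - F * x * h₃

theorem kernelSeries_mul_rpop : kernelSeries * statGF rpop = 1 := by
  have hα (a : Label) (l r : LTree) : plusWeight (rightPostorder (.node a l r)) =
      plusWeight [a] * plusWeight (rightPostorder l) * plusWeight (rightPostorder r) := by
    simp only [rightPostorder, plusWeight_append]
    ring
  have hA := plusGF_eq (W := rightPostorder) rfl hα
  have hF := statGF_eq (W := rightPostorder) rfl
  have hM := gf_rootInd_ominus_plusWeight hα
  have hP := gf_rootInd_oplus_plusWeight rfl hα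
  have hp := gf_rootInd_mul_of_eq (R := Polynomial ℤ) .oplus
    (ω := fun T => minusWeight (rightPostorder T))
    (f := fun _ => 1) (g := fun T => minusWeight (rightPostorder T))
    (f' := fun T => minusWeight (rightPostorder T))
    (g' := fun T => plusWeight (rightPostorder T))
    (fun l r => by simp only [rightPostorder, minusWeight_append, minusWeight, plusWeight_append]; ring)
  have hq := gf_rootInd_mul_of_eq (R := Polynomial ℤ) .ominus
    (ω := fun T => minusWeight (rightPostorder T))
    (f := fun _ => 1) (g := fun T => minusWeight (rightPostorder T))
    (f' := fun T => minusWeight (rightPostorder T) + plusWeight (rightPostorder T))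
    (g' := fun T => plusWeight (rightPostorder T))
    (fun l r => by simp only [rightPostorder, minusWeight_append, minusWeight, plusWeight_append]; ring)
  rw [gf_diSkInd_minusWeight rfl, gf_diSkInd_mul_one, Label.swap, hM] at hp
  rw [gf_mul_add, gf_diSkInd_minusWeight rfl, gf_diSkInd_mul_one, Label.swap, hP] at hq
  simp only [gf_diSkInd_plusWeight, gf_rootInd_minusWeight, rightPostorder, minusWeight, plusWeight, map_one, map_zero,
    zero_add] at hp hq
  change statGF rpop = _ at hF
  have hR := rootGF_oplus
  have hS := diSkGF_eq
  have h0 : (1 - X * diSkGF - X : (Polynomial ℤ)⟦X⟧) ≠ 0 :=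
    ne_zero_of_constantCoeff (by simp)
  refine mul_left_cancel₀ h0 ?_
  rw [kernelSeries]
  rw [markedX] at hA ⊢
  generalize statGF rpop = F at *
  generalize plusGF rightPostorder = A at *
  generalize minusGF rightPostorder .oplus = p at *
  generalize minusGF rightPostorder .ominus = q at *
  generalize rootGF .oplus = ρ at *
  generalize diSkGF = S at *
  generalize (C Polynomial.X : (Polynomial ℤ)⟦X⟧) = t at *
  generalize (X : (Polynomial ℤ)⟦X⟧) = x at *
  have h₁ : F - A = x * S * (F - A) + x * (F - A) + x * A * F := by
    linear_combination (1 - x * S - x - x * A) * hF + hp + hq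
  have h₂ : F * ((1 - x * S - x) * (1 - x * t) - x) = 1 - x * S - x := by
    linear_combination (1 - x * t) * h₁ + (1 - x * S - x + x * F) * hA
  -- This is the Schröder equation `S = 1 + x S + x S ^ 2`: again the cancelled factor is the
  -- inverse of `S`.
  have h₃ : (1 - x * S - x) * S = 1 := by
    linear_combination (1 - x * S) * hS + 2 * hR
  linear_combination h₂ - F * x * h₃

theorem equidistributed_of_kernelSeries_mul {st₁ st₂ : LTree → ℕ} (h₁ : kernelSeries * statGF st₁ = 1)
    (h₂ : kernelSeries * statGF st₂ = 1) (n : ℕ) : Equidistributed (diSkTrees n) st₁ st₂ :=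
  equidistributed_of_statGF_eq (mul_left_cancel₀ kernelSeries_ne_zero (h₁.trans h₂.symm)) n

/-! ### Values of the statistics in terms of the root and its children -/

theorem initialPlus_oplus_cons (u : List Label) :
    initialPlus (.oplus :: u) = initialPlus u + 1 := by
  simp [initialPlus]

theorem initialPlus_ominus_cons (u : List Label) : initialPlus (.ominus :: u) = 0 := by
  simp [initialPlus]

theorem level_nil (d : ℕ) : level d .nil = [] := by
  cases d <;> rfl

theorem rightLevel_nil (d : ℕ) : rightLevel d .nil = [] := by
  cases d <;> rfl

theorem levelOrder_node (a : Label) (l r : LTree) :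
    levelOrder (.node a l r) =
      a :: (List.range (max l.height r.height)).flatMap fun d => level d l ++ level d r := by
  simp [levelOrder, List.range_succ_eq_map, List.flatMap_map, level]

theorem rightLevelOrder_node (a : Label) (l r : LTree) :
    rightLevelOrder (.node a l r) =
      a :: (List.range (max l.height r.height)).flatMap fun d =>
        rightLevel d r ++ rightLevel d l := by
  simp [rightLevelOrder, List.range_succ_eq_map, List.flatMap_map, rightLevel]

theorem levelOrder_node_node (a b : Label) (l r₁ r₂ : LTree) :
    ∃ u, levelOrder (.node a l (.node b r₁ r₂)) = a :: (level 0 l ++ b :: u) := by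
  obtain ⟨h, hh⟩ : ∃ h, max l.height (BinaryTree.node b r₁ r₂).height = h + 1 :=
    Nat.exists_eq_add_one.2 (by simp)
  rw [levelOrder_node, hh, List.range_succ_eq_map, List.flatMap_cons]
  simp only [level, List.append_assoc, List.cons_append, List.nil_append]
  exact ⟨_, rfl⟩

theorem rightLevelOrder_node_node (a b : Label) (l r₁ r₂ : LTree) :
    ∃ u, rightLevelOrder (.node a l (.node b r₁ r₂)) = a :: b :: u := by
  obtain ⟨h, hh⟩ : ∃ h, max l.height (BinaryTree.node b r₁ r₂).height = h + 1 :=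
    Nat.exists_eq_add_one.2 (by simp)
  rw [rightLevelOrder_node, hh, List.range_succ_eq_map, List.flatMap_cons]
  simp only [rightLevel, List.cons_append, List.nil_append]
  exact ⟨_, rfl⟩

theorem rtop_node_ominus (l r : LTree) : rtop (.node .ominus l r) = 0 := by
  simp [rtop, rightPreorder, initialPlus_ominus_cons]

theorem rtop_node_oplus_nil (l : LTree) : rtop (.node .oplus l .nil) = rtop l + 1 := by
  simp [rtop, rightPreorder, initialPlus_oplus_cons]

theorem rtop_node_oplus_node_ominus (l r₁ r₂ : LTree) :
    rtop (.node .oplus l (.node .ominus r₁ r₂)) = 1 := by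
  simp [rtop, rightPreorder, initialPlus_oplus_cons, initialPlus_ominus_cons]

theorem rlop_node_ominus (l r : LTree) : rlop (.node .ominus l r) = 0 := by
  simp [rlop, rightLevelOrder_node, initialPlus_ominus_cons]

theorem rlop_node_oplus_nil (l : LTree) : rlop (.node .oplus l .nil) = rlop l + 1 := by
  simp [rlop, rightLevelOrder_node, initialPlus_oplus_cons, rightLevel_nil,
    rightLevelOrder.eq_def l]

theorem rlop_node_oplus_node_ominus (l r₁ r₂ : LTree) :
    rlop (.node .oplus l (.node .ominus r₁ r₂)) = 1 := by
  obtain ⟨u, hu⟩ := rightLevelOrder_node_node .oplus .ominus l r₁ r₂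
  simp [rlop, hu, initialPlus_oplus_cons, initialPlus_ominus_cons]

theorem lop_node_ominus (l r : LTree) : lop (.node .ominus l r) = 0 := by
  simp [lop, levelOrder_node, initialPlus_ominus_cons]

theorem lop_node_oplus_nil (l : LTree) : lop (.node .oplus l .nil) = lop l + 1 := by
  simp [lop, levelOrder_node, initialPlus_oplus_cons, level_nil, levelOrder.eq_def l]

/-- Only the root and the left child are visited before the right child `⊖`. -/
theorem lop_node_oplus_node_ominus_le (l r₁ r₂ : LTree) :
    lop (.node .oplus l (.node .ominus r₁ r₂)) ≤ 2 := by
  obtain ⟨u, hu⟩ := levelOrder_node_node .oplus .ominus l r₁ r₂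
  rcases l with _ | ⟨_ | _, l₁, l₂⟩ <;>
    simp [lop, hu, initialPlus_oplus_cons, initialPlus_ominus_cons, level]

theorem top_node_ominus (l r : LTree) : top (.node .ominus l r) = 0 := by
  simp [top, preorder, initialPlus_ominus_cons]

theorem top_node_oplus_nil (l : LTree) : top (.node .oplus l .nil) = top l + 1 := by
  simp [top, preorder, initialPlus_oplus_cons]

theorem rtop_eq_rlop {T : LTree} (hT : IsDiSk T) : rtop T = rlop T := by
  induction T with
  | nil => simp [rtop, rlop, rightPreorder, rightLevelOrder]
  | node a l r ihl _ =>
    obtain ⟨hr, hl, -⟩ := hT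
    cases a
    · rcases r with _ | ⟨_ | _, r₁, r₂⟩
      · rw [rtop_node_oplus_nil, rlop_node_oplus_nil, ihl hl]
      · exact absurd rfl hr
      · rw [rtop_node_oplus_node_ominus, rlop_node_oplus_node_ominus]
    · rw [rtop_node_ominus, rlop_node_ominus]

/-! ### Trees whose statistic is one less than the number of nodes -/

/-- The di-sk trees with `m` nodes on which a statistic has the value `k`. -/
def fiber (st : LTree → ℕ) (m k : ℕ) : Set LTree := {T ∈ diSkTrees (m + 1) | st T = k}

theorem mem_fiber {st : LTree → ℕ} {m k : ℕ} {T : LTree} :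
    T ∈ fiber st m k ↔ IsDiSk T ∧ T.numNodes = m ∧ st T = k := by
  simp [fiber, diSkTrees, and_assoc]

theorem finite_fiber (st : LTree → ℕ) (m k : ℕ) : (fiber st m k).Finite :=
  (finite_diSkTrees _).subset fun _ hT => hT.1

/-- Adding a root labeled `⊕` with no right child. -/
def addRoot (T : LTree) : LTree := .node .oplus T .nil

theorem addRoot_injective : Function.Injective addRoot := fun _ _ h => by
  simpa [addRoot] using h

theorem image_addRoot_fiber_subset {st : LTree → ℕ} (h : ∀ T, st (addRoot T) = st T + 1)
    (m k : ℕ) : addRoot '' fiber st m k ⊆ fiber st (m + 1) (k + 1) := by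
  rintro _ ⟨T, hT, rfl⟩
  rw [mem_fiber] at hT ⊢
  refine ⟨⟨by simp [rootLabel], hT.1, trivial⟩, ?_, by rw [h, hT.2.2]⟩
  simp [addRoot, hT.2.1]

/-- A value above `k` excludes a root `⊖` and a right child `⊖`, so every tree in the larger fiber
arises from `addRoot`. The count is therefore constant along the diagonal once the value exceeds the
bound: 1 for `rtop`, 2 for `lop`. -/
theorem ncard_fiber_succ {st : LTree → ℕ} (h : ∀ T, st (addRoot T) = st T + 1) {k : ℕ}
    (hominus : ∀ l r, st (.node .ominus l r) = 0)
    (hoplus : ∀ l r₁ r₂, st (.node .oplus l (.node .ominus r₁ r₂)) ≤ k) (m : ℕ) :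
    (fiber st (m + 1) (k + 1)).ncard = (fiber st m k).ncard := by
  rw [← Set.ncard_image_of_injective (fiber st m k) addRoot_injective]
  congr 1
  refine Set.Subset.antisymm ?_ (image_addRoot_fiber_subset h m k)
  intro T hT
  obtain ⟨hd, hn, hs⟩ := mem_fiber.1 hT
  rcases T with _ | ⟨_ | _, l, _ | ⟨_ | _, r₁, r₂⟩⟩
  · simp at hn
  · refine ⟨l, mem_fiber.2 ⟨hd.2.1, by simpa using hn, ?_⟩, rfl⟩
    have := h l
    rw [addRoot, hs] at this
    omega
  · exact absurd rfl hd.1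
  · have := hoplus l r₁ r₂
    omega
  all_goals
    rw [hominus] at hs
    omega

/-- The tree with one node. -/
def leaf (a : Label) : LTree := .node a .nil .nil

theorem numNodes_eq_one {T : LTree} (h : T.numNodes = 1) : ∃ a, T = leaf a := by
  rcases T with _ | ⟨a, _ | ⟨b, l₁, l₂⟩, _ | ⟨c, r₁, r₂⟩⟩
  · simp at h
  · exact ⟨a, rfl⟩
  all_goals
    simp only [BinaryTree.numNodes] at h
    omega

theorem numNodes_eq_two {T : LTree} (h : T.numNodes = 2) :
    ∃ a b, T = .node a .nil (leaf b) ∨ T = .node a (leaf b) .nil := by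
  rcases T with _ | ⟨a, _ | ⟨b, l₁, l₂⟩, r⟩
  · simp at h
  · obtain ⟨b, rfl⟩ := numNodes_eq_one (T := r) (by simpa using h)
    exact ⟨a, b, .inl rfl⟩
  · have hr : r = .nil := by
      cases r
      · rfl
      · simp only [BinaryTree.numNodes] at h
        omega
    subst hr
    obtain ⟨c, hc⟩ := numNodes_eq_one (T := .node b l₁ l₂) (by simpa using h)
    exact ⟨a, c, .inr (by rw [hc])⟩

theorem numNodes_eq_three {T : LTree} (h : T.numNodes = 3) :
    ∃ a b c, T = .node a .nil (.node b .nil (leaf c)) ∨ T = .node a .nil (.node b (leaf c) .nil) ∨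
      T = .node a (leaf b) (leaf c) ∨ T = .node a (.node b .nil (leaf c)) .nil ∨
      T = .node a (.node b (leaf c) .nil) .nil := by
  rcases T with _ | ⟨a, l, r⟩
  · simp at h
  · simp only [BinaryTree.numNodes] at h
    have hl : l.numNodes = 0 ∨ l.numNodes = 1 ∨ l.numNodes = 2 := by omega
    rcases hl with hl | hl | hl
    · have hl' : l = .nil := by
        cases l
        · rfl
        · simp at hl
      obtain ⟨b, c, rfl | rfl⟩ := numNodes_eq_two (T := r) (by omega) <;>
        exact ⟨a, b, c, by simp [hl']⟩
    · obtain ⟨b, rfl⟩ := numNodes_eq_one hl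
      obtain ⟨c, rfl⟩ := numNodes_eq_one (T := r) (by omega)
      exact ⟨a, b, c, by simp⟩
    · have hr' : r = .nil := by
        cases r
        · rfl
        · simp only [BinaryTree.numNodes] at h
          omega
      obtain ⟨b, c, rfl | rfl⟩ := numNodes_eq_two hl <;> exact ⟨a, b, c, by simp [hr']⟩

theorem fiber_rtop_two_subset :
    fiber rtop 2 1 ⊆ {.node .oplus .nil (leaf .ominus), .node .oplus (leaf .ominus) .nil} := by
  intro T hT
  obtain ⟨hd, hn, hs⟩ := mem_fiber.1 hT
  obtain ⟨a, b, rfl | rfl⟩ := numNodes_eq_two hn <;> cases a <;> cases b <;>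
    simp_all [leaf, IsDiSk, rootLabel, rtop_node_oplus_nil, rtop_node_ominus]

theorem ncard_fiber_rtop_le (m : ℕ) : (fiber rtop (m + 2) (m + 1)).ncard ≤ 2 := by
  induction m with
  | zero =>
    refine (Set.ncard_le_ncard fiber_rtop_two_subset (Set.toFinite _)).trans ?_
    exact (Set.ncard_insert_le _ _).trans (by simp)
  | succ m ih =>
    rwa [ncard_fiber_succ (st := rtop) rtop_node_oplus_nil rtop_node_ominus
      fun l r₁ r₂ => by rw [rtop_node_oplus_node_ominus]; omega]

theorem fiber_lop_three : fiber lop 3 2 =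
    {.node .oplus (leaf .oplus) (leaf .ominus),
      .node .oplus (.node .oplus .nil (leaf .ominus)) .nil,
      .node .oplus (.node .oplus (leaf .ominus) .nil) .nil} := by
  ext T
  rw [mem_fiber]
  constructor
  · rintro ⟨hd, hn, hs⟩
    obtain ⟨a, b, c, rfl | rfl | rfl | rfl | rfl⟩ := numNodes_eq_three hn <;> cases a <;>
      cases b <;> cases c <;> first
        | simp; done
        | exact absurd hs (by decide)
        | simp [leaf, IsDiSk, rootLabel] at hd
  · rintro (rfl | rfl | rfl) <;> refine ⟨?_, rfl, by decide⟩ <;> simp [leaf, IsDiSk, rootLabel]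

theorem ncard_fiber_lop (m : ℕ) : (fiber lop (m + 3) (m + 2)).ncard = 3 := by
  induction m with
  | zero =>
    rw [fiber_lop_three, Set.ncard_eq_toFinset_card']
    rfl
  | succ m ih =>
    rwa [ncard_fiber_succ (st := lop) lop_node_oplus_nil lop_node_ominus
      fun l r₁ r₂ => (lop_node_oplus_node_ominus_le l r₁ r₂).trans (by omega)]

/-- The left chain with `m` nodes labeled `⊕`. -/
def chain : ℕ → LTree
  | 0 => .nil
  | m + 1 => addRoot (chain m)

theorem isDiSk_chain (m : ℕ) : IsDiSk (chain m) := by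
  induction m with
  | zero => trivial
  | succ m ih => exact ⟨by simp [rootLabel], ih, trivial⟩

theorem numNodes_chain (m : ℕ) : (chain m).numNodes = m := by
  induction m with
  | zero => rfl
  | succ m ih => simp [chain, addRoot, ih]

theorem initialPlus_preorder_chain_append (m : ℕ) :
    initialPlus (preorder (chain m) ++ [.ominus]) = m := by
  induction m with
  | zero => rfl
  | succ m ih => simpa [chain, addRoot, preorder, initialPlus_oplus_cons] using ih

/-- Each size adds a tree outside the image of `addRoot`: preorder runs through the whole left chain
of `⊕` before it meets a right child `⊖` of the root. -/
theorem le_ncard_fiber_top (m : ℕ) : m + 1 ≤ (fiber top (m + 1) m).ncard := by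
  induction m with
  | zero =>
    refine (Set.ncard_pos (finite_fiber _ _ _)).2 ⟨leaf .ominus, mem_fiber.2 ⟨?_, rfl, ?_⟩⟩
    · exact ⟨by simp [rootLabel], trivial, trivial⟩
    · exact top_node_ominus _ _
  | succ m ih =>
    have hmem : BinaryTree.node .oplus (chain m) (leaf .ominus) ∈ fiber top (m + 2) (m + 1) := by
      refine mem_fiber.2 ⟨⟨by simp [rootLabel, leaf], isDiSk_chain m, by simp [rootLabel],
        trivial, trivial⟩, by simp [leaf, numNodes_chain], ?_⟩
      simp [top, preorder, leaf, initialPlus_oplus_cons, initialPlus_preorder_chain_append]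
    have hnot : BinaryTree.node .oplus (chain m) (leaf .ominus) ∉
        addRoot '' fiber top (m + 1) m := by
      rintro ⟨T, -, hT⟩
      simp [addRoot, leaf] at hT
    have hsub := Set.insert_subset hmem (image_addRoot_fiber_subset top_node_oplus_nil (m + 1) m)
    have := Set.ncard_le_ncard hsub (finite_fiber _ _ _)
    change _ ≤ (fiber top (m + 1 + 1) (m + 1)).ncard at this
    rw [Set.ncard_insert_of_notMem hnot ((finite_fiber _ _ _).image _),
      Set.ncard_image_of_injective _ addRoot_injective] at this
    omega

/-! ### Separating the three classes -/

theorem Equidistributed.trans {S : Set LTree} {st₁ st₂ st₃ : LTree → ℕ}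
    (h₁ : Equidistributed S st₁ st₂) (h₂ : Equidistributed S st₂ st₃) :
    Equidistributed S st₁ st₃ := fun k => (h₁ k).trans (h₂ k)

theorem Equidistributed.symm {S : Set LTree} {st₁ st₂ : LTree → ℕ}
    (h : Equidistributed S st₁ st₂) : Equidistributed S st₂ st₁ := fun k => (h k).symm

theorem equidistributed_of_eqOn {S : Set LTree} {st₁ st₂ : LTree → ℕ}
    (h : ∀ T ∈ S, st₁ T = st₂ T) : Equidistributed S st₁ st₂ := fun k => by
  congr 1
  ext T
  constructor
  · rintro ⟨hT, rfl⟩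
    exact ⟨hT, (h T hT).symm⟩
  · rintro ⟨hT, rfl⟩
    exact ⟨hT, h T hT⟩

theorem equidistributed_top {st : LTree → ℕ}
    (hst : st ∈ ({riop, iop, top, pop, rpop} : Set (LTree → ℕ))) (n : ℕ) :
    Equidistributed (diSkTrees n) top st := by
  refine equidistributed_of_kernelSeries_mul kernelSeries_mul_top ?_ n
  rcases hst with rfl | rfl | rfl | rfl | rfl
  · exact kernelSeries_mul_riop
  · exact kernelSeries_mul_iop
  · exact kernelSeries_mul_top
  · exact kernelSeries_mul_pop
  · exact kernelSeries_mul_rpop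

theorem equidistributed_rtop {st : LTree → ℕ}
    (hst : st ∈ ({rtop, rlop} : Set (LTree → ℕ))) (n : ℕ) :
    Equidistributed (diSkTrees n) rtop st := by
  rcases hst with rfl | rfl
  · exact equidistributed_of_eqOn fun _ _ => rfl
  · exact equidistributed_of_eqOn fun _ hT => rtop_eq_rlop hT.1

theorem not_equidistributed_lop_top {n : ℕ} (hn : 5 ≤ n) :
    ¬ Equidistributed (diSkTrees n) lop top := by
  obtain ⟨m, rfl⟩ := Nat.exists_eq_add_of_le hn
  intro h
  have h₁ : (fiber lop (m + 1 + 3) (m + 1 + 2)).ncard = 3 := ncard_fiber_lop (m + 1)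
  have h₂ : m + 3 + 1 ≤ (fiber top (m + 3 + 1) (m + 3)).ncard := le_ncard_fiber_top (m + 3)
  -- There are `m + 4` nodes, so this compares the counts at one below the maximum: 3 against at
  -- least `m + 4`.
  have h₃ := h (m + 3)
  rw [add_comm 5 m] at h₃
  change (fiber lop (m + 1 + 3) (m + 1 + 2)).ncard = (fiber top (m + 3 + 1) (m + 3)).ncard at h₃
  omega

theorem not_equidistributed_lop_rtop {n : ℕ} (hn : 5 ≤ n) :
    ¬ Equidistributed (diSkTrees n) lop rtop := by
  obtain ⟨m, rfl⟩ := Nat.exists_eq_add_of_le hn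
  intro h
  have h₁ : (fiber lop (m + 1 + 3) (m + 1 + 2)).ncard = 3 := ncard_fiber_lop (m + 1)
  have h₂ : (fiber rtop (m + 2 + 2) (m + 2 + 1)).ncard ≤ 2 := ncard_fiber_rtop_le (m + 2)
  have h₃ := h (m + 3)
  rw [add_comm 5 m] at h₃
  change (fiber lop (m + 1 + 3) (m + 1 + 2)).ncard =
    (fiber rtop (m + 2 + 2) (m + 2 + 1)).ncard at h₃
  omega

theorem not_equidistributed_top_rtop {n : ℕ} (hn : 5 ≤ n) :
    ¬ Equidistributed (diSkTrees n) top rtop := by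
  obtain ⟨m, rfl⟩ := Nat.exists_eq_add_of_le hn
  intro h
  have h₁ : m + 3 + 1 ≤ (fiber top (m + 3 + 1) (m + 3)).ncard := le_ncard_fiber_top (m + 3)
  have h₂ : (fiber rtop (m + 2 + 2) (m + 2 + 1)).ncard ≤ 2 := ncard_fiber_rtop_le (m + 2)
  have h₃ := h (m + 3)
  rw [add_comm 5 m] at h₃
  change (fiber top (m + 3 + 1) (m + 3)).ncard =
    (fiber rtop (m + 2 + 2) (m + 2 + 1)).ncard at h₃
  omega

end DiSk

theorem theorem4p1 (n : ℕ) :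
    (∀ T ∈ DiSk.diSkTrees n, DiSk.rtop T = DiSk.rlop T) ∧
    (DiSk.Equidistributed (DiSk.diSkTrees n) DiSk.riop DiSk.iop ∧
      DiSk.Equidistributed (DiSk.diSkTrees n) DiSk.iop DiSk.top ∧
      DiSk.Equidistributed (DiSk.diSkTrees n) DiSk.top DiSk.pop ∧
      DiSk.Equidistributed (DiSk.diSkTrees n) DiSk.pop DiSk.rpop) ∧
    (5 ≤ n →
      (∀ st ∈ ({DiSk.riop, DiSk.iop, DiSk.top, DiSk.pop, DiSk.rpop, DiSk.rtop, DiSk.rlop} :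
          Set (DiSk.LTree → ℕ)),
        ¬ DiSk.Equidistributed (DiSk.diSkTrees n) DiSk.lop st) ∧
      (∀ st ∈ ({DiSk.riop, DiSk.iop, DiSk.top, DiSk.pop, DiSk.rpop} :
          Set (DiSk.LTree → ℕ)),
        ∀ st' ∈ ({DiSk.rtop, DiSk.rlop} : Set (DiSk.LTree → ℕ)),
          ¬ DiSk.Equidistributed (DiSk.diSkTrees n) st st')) := by
  open DiSk in
  refine ⟨fun T hT => rtop_eq_rlop hT.1,
    ⟨equidistributed_of_kernelSeries_mul kernelSeries_mul_riop kernelSeries_mul_iop n,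
      equidistributed_of_kernelSeries_mul kernelSeries_mul_iop kernelSeries_mul_top n,
      equidistributed_of_kernelSeries_mul kernelSeries_mul_top kernelSeries_mul_pop n,
      equidistributed_of_kernelSeries_mul kernelSeries_mul_pop kernelSeries_mul_rpop n⟩,
    fun hn => ⟨fun st hst h => ?_, fun st hst st' hst' h => ?_⟩⟩
  -- By transitivity it suffices to separate `lop` from the representatives `top` and `rtop`.
  · have hst₂ : st ∈ ({riop, iop, top, pop, rpop} : Set (LTree → ℕ)) ∨
        st ∈ ({rtop, rlop} : Set (LTree → ℕ)) := by
      simp only [Set.mem_insert_iff, Set.mem_singleton_iff] at hst ⊢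
      tauto
    rcases hst₂ with hst₂ | hst₂
    · exact not_equidistributed_lop_top hn (h.trans (equidistributed_top hst₂ n).symm)
    · exact not_equidistributed_lop_rtop hn (h.trans (equidistributed_rtop hst₂ n).symm)
  · exact not_equidistributed_top_rtop hn
      (((equidistributed_top hst n).trans h).trans (equidistributed_rtop hst' n).symm)
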